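/- Let $G=(V,E)$ be a finite simple graph drawn in the plane as a 1-plane graph with embedding $\gamma$ (each edge is a simple curve with at most one crossing, and crossings are proper); let $\chi$ be its set of crossings and let $\mathcal G$ be the planarization, the plane graph on $V\cup\chi$ obtained by regarding crossings as vertices. Assume $(G,\gamma)$ is circular: for any two crossing edges $u_1u_3$ and $u_2u_4$ there are vertices $w_1,\dots,w_4$ of degree $2$ in $G$ such that $(u_1,w_1,u_2,w_2,u_3,w_3,u_4,w_4)$ is a cycle of eight crossing-free edges. *Definitions.* They apply to $\mathcal G$ and to the embedding $\gamma|_B$ of a block (maximal biconnected subgraph) $B$ of $\mathcal G$ obtained from the drawing by deleting everything not in $B$; write $H$ for $\mathcal G$ or $B$. Interior and exterior of a cycle are the open regions inside and outside it, so the cycle belongs to neither. Consider cycles $C=(u,c,v,s)$ of $H$ with $u,v\in V$, $c,s\in\chi$. Such a $C$ is a *posi-cycle* if (1) its interior contains neither a crossing-free edge $uv$ nor a crossing other than $c,s$ that is adjacent to both $u$ and $v$; (2) its exterior contains at most one vertex of $V\setminus\{u,v\}$ adjacent to $c$ or $s$ (exactly one: B-cycle; none: W-cycle); and (3) its interior contains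 no face with both $u$ and $v$ on its boundary. It is a *nega-cycle* if (1)–(3) hold with "interior" and "exterior" exchanged. A vertex $z\in V$ is an *in-factor* of a posi-cycle (resp. nega-cycle) $C$ if $H$ has a $z,u$-path and a $z,v$-path all of whose vertices, except the end $u$, resp. $v$, lie in the exterior (resp. interior) of $C$. A pair $\{C,C'\}$ of a posi-cycle $C=(u,c,v,s)$ and a posi- or nega-cycle $C'=(u',c',v',s')$ is a *forbidden cycle pair* in $H$ if $H$ has a $u,u'$-path $P_1$ and a $v,v'$-path $P_2$ such that: if $C'$ is a posi-cycle, then no face lies in the interior of both $C$ and $C'$, and all vertices of $P_1$ other than $u,u'$ and all vertices of $P_2$ other than $v,v'$ lie in the exterior of $C$ and in the exterior of $C'$; if $C'$ is a nega-cycle, then every face in the interior of $C$ is in the interior of $C'$, and all vertices of $P_1$ other than $u,u'$ and all vertices of $P_2$ other than $v,v'$ lie in the exterior of $C$ and in the interior of $C'$. **Lemma.** Suppose that $\mathcal G$ has vertex-connectivity $1$, i.e. is connected and has a cut-vertex. Let $B_1\ne B_2$ be blocks of $\mathcal G$, and let $P_{1,2}$ be a $z_1,z_2$-path of $\mathcal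 G$ with the minimum number of edges, where $z_1,z_2\in V$ and $V(B_i)\cap V(P_{1,2})=\{z_i\}$ for $i=1,2$. If, for each $i=1,2$, $C_i$ is a posi- or nega-cycle of $\gamma|_{B_i}$ to which $z_i$ is an in-factor, then $\{C_1,C_2\}$ is a forbidden cycle pair in $\mathcal G$. -/

import Mathlib

namespace OnePlane

/-- The Euclidean plane. -/
abbrev Plane := EuclideanSpace ℝ (Fin 2)

/-- A drawing of a simple graph in the plane: vertices are distinct points and every edge is a
simple curve between its end-vertices that passes through no other vertex.  The curve of an edge is
parametrized once for each of its two traversal directions (darts). -/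
structure Drawing {V : Type*} (G : SimpleGraph V) where
  pos : V → Plane
  pos_injective : Function.Injective pos
  arc : (d : G.Dart) → Path (pos d.fst) (pos d.snd)
  arc_symm : ∀ (d : G.Dart) (t : unitInterval), arc d.symm t = arc d (unitInterval.symm t)
  arc_injective : ∀ d : G.Dart, Function.Injective (arc d)
  eq_end_of_mem : ∀ (d : G.Dart) (v : V), pos v ∈ Set.range (arc d) → v = d.fst ∨ v = d.snd

namespace Drawing

variable {V : Type*} {G : SimpleGraph V} (D : Drawing G)

/-- The (curves of the) two distinct edges underlying `d` and `d'` share the point `x`, and `x` is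
not a vertex. -/
def CrossAt (d d' : G.Dart) (x : Plane) : Prop :=
  d.edge ≠ d'.edge ∧ x ∈ Set.range (D.arc d) ∧ x ∈ Set.range (D.arc d') ∧ ∀ v : V, x ≠ D.pos v

/-- The curves of `d` and `d'` cross properly at `x` (rather than touch): near `x`, up to a
homeomorphism, they are the two coordinate axes. -/
def ProperAt (d d' : G.Dart) (x : Plane) : Prop :=
  ∃ φ : OpenPartialHomeomorph Plane Plane, x ∈ φ.source ∧ ∀ y ∈ φ.source,
    (y ∈ Set.range (D.arc d) ↔ φ y 1 = 0) ∧ (y ∈ Set.range (D.arc d') ↔ φ y 0 = 0)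

/-- 1-planar drawings: distinct edges meet, apart from common end-vertices, in proper crossings
only, and each edge has at most one crossing. -/
structure IsOnePlanar : Prop where
  proper : ∀ d d' x, D.CrossAt d d' x → D.ProperAt d d' x
  at_most_one : ∀ d d₁ d₂ x₁ x₂, D.CrossAt d d₁ x₁ → D.CrossAt d d₂ x₂ →
    d₁.edge = d₂.edge ∧ x₁ = x₂

/-- The crossings of the drawing. -/
def Crossing : Type := {x : Plane // ∃ d d', D.CrossAt d d' x}

/-- Vertices of the planarization: the vertices of the graph and the crossing-vertices. -/
abbrev PVertex : Type _ := V ⊕ D.Crossing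

/-- The point at which a vertex of the planarization is drawn. -/
def point : D.PVertex → Plane
  | Sum.inl v => D.pos v
  | Sum.inr x => x.1

/-- Adjacency in the planarization of a 1-planar drawing: crossing-free edges between vertices of
the graph, and half-edges between a crossing and the end-vertices of the two edges crossing there.
(Two crossings are never adjacent, as every edge has at most one crossing.) -/
def PAdj : D.PVertex → D.PVertex → Prop
  | Sum.inl u, Sum.inl v =>
      ∃ d : G.Dart, d.fst = u ∧ d.snd = v ∧ ∀ d' x, ¬ D.CrossAt d d' x
  | Sum.inl u, Sum.inr x => ∃ d : G.Dart, d.fst = u ∧ x.1 ∈ Set.range (D.arc d)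
  | Sum.inr x, Sum.inl u => ∃ d : G.Dart, d.fst = u ∧ x.1 ∈ Set.range (D.arc d)
  | Sum.inr _, Sum.inr _ => False

theorem CrossAt.symm_left {d d' : G.Dart} {x : Plane} (h : D.CrossAt d.symm d' x) :
    D.CrossAt d d' x := by
  obtain ⟨h1, h2, h3, h4⟩ := h
  refine ⟨by simpa using h1, ?_, h3, h4⟩
  obtain ⟨t, rfl⟩ := h2
  exact ⟨unitInterval.symm t, (D.arc_symm d t).symm⟩

/-- The planarization. -/
def planarization : SimpleGraph D.PVertex where
  Adj := D.PAdj
  symm := ⟨by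
    rintro (u | x) (v | y) h
    · obtain ⟨d, h1, h2, h3⟩ := h
      exact ⟨d.symm, h2, h1, fun d' x hx => h3 d' x (CrossAt.symm_left D hx)⟩
    · exact h
    · exact h
    · exact h⟩
  loopless := ⟨by
    rintro (u | x) h
    · obtain ⟨d, h1, h2, -⟩ := h
      exact d.fst_ne_snd (h1.trans h2.symm)
    · exact h⟩

/-- The initial part, from `u` to the crossing `x`, of an edge that leaves `u` and passes through
`x`. -/
def halfEdge (u : V) (x : D.Crossing) : Set Plane :=
  {y | ∃ (d : G.Dart) (s t : unitInterval),
    d.fst = u ∧ D.arc d t = x.1 ∧ s ≤ t ∧ D.arc d s = y}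

/-- The curve by which an edge of the planarization is drawn. -/
def curve : D.PVertex → D.PVertex → Set Plane
  | Sum.inl u, Sum.inl v =>
      {y | ∃ d : G.Dart, d.fst = u ∧ d.snd = v ∧ y ∈ Set.range (D.arc d)}
  | Sum.inl u, Sum.inr x => D.halfEdge u x
  | Sum.inr x, Sum.inl u => D.halfEdge u x
  | Sum.inr _, Sum.inr _ => ∅

/-- The point set of the drawing of a subgraph `H` of the planarization, i.e. of the sub-embedding
induced by `H`. -/
def carrier (H : D.planarization.Subgraph) : Set Plane :=
  {y | (∃ a ∈ H.verts, y = D.point a) ∨ ∃ a b, H.Adj a b ∧ y ∈ D.curve a b}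

/-- The faces of the sub-embedding induced by `H`: the connected regions into which the plane is
divided by the drawing of `H`. -/
def IsFace (H : D.planarization.Subgraph) (f : Set Plane) : Prop :=
  ∃ x ∈ (D.carrier H)ᶜ, f = connectedComponentIn (D.carrier H)ᶜ x

/-- Circular instances: the end-vertices `u₁, u₃` and `u₂, u₄` of any two crossing edges lie on
a cycle `(u₁, w₁, u₂, w₂, u₃, w₃, u₄, w₄)` of crossing-free edges, each `wᵢ` having degree 2. -/
def IsCircular : Prop :=
  ∀ (d d' : G.Dart) (x : Plane), D.CrossAt d d' x →
    ∃ w₁ w₂ w₃ w₄ : V,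
      [d.fst, w₁, d'.fst, w₂, d.snd, w₃, d'.snd, w₄].Nodup ∧
      D.planarization.Adj (Sum.inl d.fst) (Sum.inl w₁) ∧
      D.planarization.Adj (Sum.inl w₁) (Sum.inl d'.fst) ∧
      D.planarization.Adj (Sum.inl d'.fst) (Sum.inl w₂) ∧
      D.planarization.Adj (Sum.inl w₂) (Sum.inl d.snd) ∧
      D.planarization.Adj (Sum.inl d.snd) (Sum.inl w₃) ∧
      D.planarization.Adj (Sum.inl w₃) (Sum.inl d'.snd) ∧
      D.planarization.Adj (Sum.inl d'.snd) (Sum.inl w₄) ∧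
      D.planarization.Adj (Sum.inl w₄) (Sum.inl d.fst) ∧
      (∀ w ∈ [w₁, w₂, w₃, w₄], (G.neighborSet w).encard = 2)

/-- A labelled quadruple `(u, c, v, s)` of two distinct vertices and two distinct crossings. -/
structure Quad where
  u : V
  v : V
  c : D.Crossing
  s : D.Crossing
  u_ne_v : u ≠ v
  c_ne_s : c ≠ s

namespace Quad

variable {D}
variable (H : D.planarization.Subgraph) (C : D.Quad)

/-- `(u, c, v, s)` is a cycle of `H`. -/
def IsCycleOf : Prop :=
  H.Adj (Sum.inl C.u) (Sum.inr C.c) ∧ H.Adj (Sum.inr C.c) (Sum.inl C.v) ∧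
  H.Adj (Sum.inl C.v) (Sum.inr C.s) ∧ H.Adj (Sum.inr C.s) (Sum.inl C.u)

/-- The closed curve by which the cycle `(u, c, v, s)` is drawn. -/
def curve : Set Plane :=
  D.halfEdge C.u C.c ∪ D.halfEdge C.v C.c ∪ D.halfEdge C.v C.s ∪ D.halfEdge C.u C.s

/-- The open region enclosed by the cycle. -/
def interior : Set Plane :=
  {x | x ∉ C.curve ∧ Bornology.IsBounded (connectedComponentIn C.curveᶜ x)}

/-- The open region outside the cycle. -/
def exterior : Set Plane :=
  {x | x ∉ C.curve ∧ ¬ Bornology.IsBounded (connectedComponentIn C.curveᶜ x)}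

/-- The faces of `H` in the interior of the cycle. -/
def facesIn : Set (Set Plane) := {f | D.IsFace H f ∧ f ⊆ C.interior}

/-- The side `R` of the cycle contains neither a crossing-free edge `uv` of `H` nor another
crossing-vertex of `H` adjacent to both `u` and `v`. -/
def NoShortcut (R : Set Plane) : Prop :=
  ¬ (H.Adj (Sum.inl C.u) (Sum.inl C.v) ∧
      D.curve (Sum.inl C.u) (Sum.inl C.v) \ {D.pos C.u, D.pos C.v} ⊆ R) ∧
  ∀ c' : D.Crossing, c' ≠ C.c → c' ≠ C.s →
    H.Adj (Sum.inl C.u) (Sum.inr c') → H.Adj (Sum.inl C.v) (Sum.inr c') → c'.1 ∉ R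

/-- The vertices other than `u`, `v` on the side `R` of the cycle that are adjacent to `c`
or `s`. -/
def sideNeighbors (R : Set Plane) : Set V :=
  {x | x ≠ C.u ∧ x ≠ C.v ∧ D.pos x ∈ R ∧
    (H.Adj (Sum.inl x) (Sum.inr C.c) ∨ H.Adj (Sum.inl x) (Sum.inr C.s))}

/-- No face of `H` on the side `R` of the cycle has both `u` and `v` on its boundary. -/
def NoCommonFace (R : Set Plane) : Prop :=
  ¬ ∃ f, D.IsFace H f ∧ f ⊆ R ∧ D.pos C.u ∈ frontier f ∧ D.pos C.v ∈ frontier f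

/-- Candidate posi-cycles of length 4. -/
def IsCandidatePosi : Prop := C.IsCycleOf H ∧ C.NoShortcut H C.interior

/-- Candidate nega-cycles of length 4. -/
def IsCandidateNega : Prop := C.IsCycleOf H ∧ C.NoShortcut H C.exterior

/-- B-cycles of length 4. -/
def IsBCycle : Prop := C.IsCandidatePosi H ∧ (C.sideNeighbors H C.exterior).encard = 1

/-- W-cycles. -/
def IsWCycle : Prop := C.IsCandidatePosi H ∧ C.sideNeighbors H C.exterior = ∅

/-- Posi-cycles, i.e. hard B- or W-cycles (hard cycles have length 4 by definition). -/
def IsPosi : Prop := (C.IsBCycle H ∨ C.IsWCycle H) ∧ C.NoCommonFace H C.interior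

/-- Nega-cycles. -/
def IsNega : Prop :=
  C.IsCandidateNega H ∧ (C.sideNeighbors H C.interior).encard ≤ 1 ∧ C.NoCommonFace H C.exterior

end Quad

/-- `H` has a (simple) path from `a` to `b` all of whose vertices outside `E` lie in the
region `R`. -/
def HasPathIn (H : D.planarization.Subgraph) (R : Set Plane) (a b : D.PVertex)
    (E : Set D.PVertex) : Prop :=
  ∃ p : D.planarization.Walk a b, p.IsPath ∧ p.toSubgraph ≤ H ∧
    ∀ w ∈ p.support, w ∉ E → D.point w ∈ R

namespace Quad

variable {D}
variable (H : D.planarization.Subgraph)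

/-- `C` is a posi- or nega-cycle of `H` to which the vertex `z` is an in-factor: the exterior
(posi-cycle) or interior (nega-cycle) of `C` contains a path from `z` to `u` and one from `z` to
`v`, apart from the last vertices `u` and `v` of these paths. -/
def HasInFactor (C : D.Quad) (z : V) : Prop :=
  (C.IsPosi H ∧
    D.HasPathIn H C.exterior (Sum.inl z) (Sum.inl C.u) {Sum.inl C.u} ∧
    D.HasPathIn H C.exterior (Sum.inl z) (Sum.inl C.v) {Sum.inl C.v}) ∨
  (C.IsNega H ∧
    D.HasPathIn H C.interior (Sum.inl z) (Sum.inl C.u) {Sum.inl C.u} ∧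
    D.HasPathIn H C.interior (Sum.inl z) (Sum.inl C.v) {Sum.inl C.v})

/-- `C = (u, c, v, s)` is a posi-cycle, `C' = (u', c', v', s')` is a posi- or nega-cycle, and there
are a `u,u'`-path and a `v,v'`-path as required for a forbidden cycle pair. -/
def ForbiddenFrom (C C' : D.Quad) : Prop :=
  C.IsPosi H ∧
  ((C'.IsPosi H ∧ Disjoint (C.facesIn H) (C'.facesIn H) ∧
      D.HasPathIn H (C.exterior ∩ C'.exterior) (Sum.inl C.u) (Sum.inl C'.u)
        {Sum.inl C.u, Sum.inl C'.u} ∧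
      D.HasPathIn H (C.exterior ∩ C'.exterior) (Sum.inl C.v) (Sum.inl C'.v)
        {Sum.inl C.v, Sum.inl C'.v}) ∨
    (C'.IsNega H ∧ C.facesIn H ⊆ C'.facesIn H ∧
      D.HasPathIn H (C.exterior ∩ C'.interior) (Sum.inl C.u) (Sum.inl C'.u)
        {Sum.inl C.u, Sum.inl C'.u} ∧
      D.HasPathIn H (C.exterior ∩ C'.interior) (Sum.inl C.v) (Sum.inl C'.v)
        {Sum.inl C.v, Sum.inl C'.v}))

/-- The unordered pair of cycles `C`, `C'`, with the given labellings, is a forbidden cycle pair. -/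
def IsForbiddenPair (C C' : D.Quad) : Prop :=
  ForbiddenFrom H C C' ∨ ForbiddenFrom H C' C

end Quad

end Drawing

/-- A biconnected subgraph: connected, with at least two vertices, and without cut-vertices.
(A single edge counts; it may be a trivial block.) -/
def IsBiconnected {W : Type*} {K : SimpleGraph W} (H : K.Subgraph) : Prop :=
  H.Connected ∧ H.verts.Nontrivial ∧ ∀ w ∈ H.verts, (H.deleteVerts {w}).Connected

/-- Blocks are the maximal biconnected subgraphs. -/
def IsBlock {W : Type*} {K : SimpleGraph W} (B : K.Subgraph) : Prop :=
  Maximal IsBiconnected B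

/-- Vertex-connectivity 1: the graph is connected and has a cut-vertex. -/
def HasConnectivityOne {W : Type*} (K : SimpleGraph W) : Prop :=
  K.Connected ∧ ∃ w : W, ¬ (K.induce ({w}ᶜ : Set W)).Preconnected

end OnePlane

/-!
A block contains every path of the graph between two of its vertices. Hence, if `B ≠ B'` are blocks
joined by a walk `P` that meets them in its ends `z`, `z'` only, then every vertex of `B'` and of
`P` is reached from `z` by a walk that avoids `B \ {z}`. Such a walk never crosses a cycle `C` of
`B`, so that `B'` and `P` are drawn on the side of `C` that contains `z`. So either cycle lies on
the in-factor's side of the other one, and the in-factor paths of the two cycles, concatenated with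
`P`, stay on both of these sides. The positions of the two curves also give the inclusion or
disjointness of the interiors, because the interior of a cycle has a boundary point on the cycle;
two nega-cycles would have exteriors that do not meet, whereas both contain all points far away.

Conditions (1)–(3) carry over from a block to the whole planarization. For (2) this needs
circularity: deleting a crossing does not separate its neighbours, so they all lie in each
block that contains the crossing and one of them.
-/

namespace OnePlane

section Blocks

open SimpleGraph

variable {W : Type*} {K : SimpleGraph W}

theorem deleteVerts_eq_self {H : K.Subgraph} {s : Set W} (h : Disjoint H.verts s) :
    H.deleteVerts s = H := by
  rw [← Subgraph.deleteVerts_inter_verts_left_eq, h.inter_eq, Subgraph.deleteVerts_empty]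

theorem le_deleteVerts {H H' : K.Subgraph} {s : Set W} (hle : H ≤ H') (h : Disjoint H.verts s) :
    H ≤ H'.deleteVerts s :=
  (deleteVerts_eq_self h).ge.trans (Subgraph.deleteVerts_mono hle)

theorem connected_of_forall_exists_walk {H H' : K.Subgraph} (hH : H.Connected) (hle : H ≤ H')
    (hreach : ∀ x ∈ H'.verts, ∃ y ∈ H.verts, ∃ q : K.Walk x y, q.toSubgraph ≤ H') :
    H'.Connected := by
  rw [Subgraph.connected_iff_forall_exists_walk_subgraph] at hH ⊢
  refine ⟨hH.1.mono hle.1, fun {x y} hx hy => ?_⟩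
  obtain ⟨x', hx', q, hq⟩ := hreach x hx
  obtain ⟨y', hy', r, hr⟩ := hreach y hy
  obtain ⟨s, hs⟩ := hH.2 hx' hy'
  refine ⟨(q.append s).append r.reverse, ?_⟩
  simp only [Walk.toSubgraph_append, Walk.toSubgraph_reverse]
  exact sup_le (sup_le hq (hs.trans hle)) hr

theorem exists_walk_to_end_avoiding {a b x w : W} {p : K.Walk a b} (hp : p.IsPath)
    (hx : x ∈ p.support) (hxw : x ≠ w) :
    ∃ y, (y = a ∨ y = b) ∧ ∃ q : K.Walk x y, q.toSubgraph ≤ p.toSubgraph ∧ w ∉ q.support := by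
  classical
  have hsplit : (p.takeUntil x hx).toSubgraph ⊔ (p.dropUntil x hx).toSubgraph = p.toSubgraph := by
    rw [← Walk.toSubgraph_append, Walk.take_spec]
  by_cases hw : w ∈ (p.takeUntil x hx).support
  · refine ⟨b, .inr rfl, p.dropUntil x hx, le_sup_right.trans hsplit.le, fun hw' => ?_⟩
    rw [← p.take_spec hx] at hp
    exact hp.ne_of_mem_support_of_append hxw.symm hw hw' rfl
  · refine ⟨a, .inl rfl, (p.takeUntil x hx).reverse, ?_, by simpa using hw⟩
    rw [Walk.toSubgraph_reverse]
    exact le_sup_left.trans hsplit.le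

theorem IsBiconnected.connected_deleteVerts {B : K.Subgraph} (hB : IsBiconnected B) (w : W) :
    (B.deleteVerts {w}).Connected := by
  by_cases hw : w ∈ B.verts
  · exact hB.2.2 w hw
  · rw [deleteVerts_eq_self (Set.disjoint_singleton_right.2 hw)]
    exact hB.1

theorem IsBiconnected.sup {B B' : K.Subgraph} (hB : IsBiconnected B) (hB' : IsBiconnected B')
    (h : (B.verts ∩ B'.verts).Nontrivial) : IsBiconnected (B ⊔ B') := by
  refine ⟨Subgraph.connected_sup hB.1.preconnected hB'.1.preconnected h.nonempty,
    hB.2.1.mono Set.subset_union_left, fun w _ => ?_⟩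
  obtain ⟨x, hx, hxw⟩ := h.exists_ne w
  have hsup : (B.deleteVerts {w} ⊔ B'.deleteVerts {w}).Connected :=
    Subgraph.connected_sup (hB.connected_deleteVerts w).preconnected
      (hB'.connected_deleteVerts w).preconnected ⟨x, ⟨hx.1, hxw⟩, ⟨hx.2, hxw⟩⟩
  exact hsup.mono
    (sup_le (Subgraph.deleteVerts_mono le_sup_left) (Subgraph.deleteVerts_mono le_sup_right))
    (Set.union_sdiff_distrib ..).symm

theorem IsBiconnected.sup_path {B : K.Subgraph} (hB : IsBiconnected B) {a b : W}
    (ha : a ∈ B.verts) (hb : b ∈ B.verts) {p : K.Walk a b} (hp : p.IsPath) :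
    IsBiconnected (B ⊔ p.toSubgraph) := by
  refine ⟨Subgraph.connected_sup hB.1.preconnected p.toSubgraph_connected.preconnected
    ⟨a, ha, p.start_mem_verts_toSubgraph⟩, hB.2.1.mono Set.subset_union_left, fun w _ => ?_⟩
  refine connected_of_forall_exists_walk (hB.connected_deleteVerts w)
    (Subgraph.deleteVerts_mono le_sup_left) ?_
  rintro x ⟨hx | hx, hxw⟩
  · exact ⟨x, ⟨hx, hxw⟩, Walk.nil,
      le_deleteVerts ((singletonSubgraph_le_iff _ _).2 (Or.inl hx)) (by simpa using hxw)⟩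
  · obtain ⟨y, hy, q, hqp, hqw⟩ :=
      exists_walk_to_end_avoiding hp (p.mem_verts_toSubgraph.1 hx) hxw
    refine ⟨y, ⟨?_, ?_⟩, q, le_deleteVerts (hqp.trans le_sup_right) (by simpa using hqw)⟩
    · rcases hy with rfl | rfl <;> assumption
    · rintro rfl
      exact hqw q.end_mem_support

theorem IsBlock.path_le {B : K.Subgraph} (hB : IsBlock B) {a b : W}
    (ha : a ∈ B.verts) (hb : b ∈ B.verts) {p : K.Walk a b} (hp : p.IsPath) :
    p.toSubgraph ≤ B :=
  le_sup_right.trans (hB.2 (hB.prop.sup_path ha hb hp) le_sup_left)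

theorem IsBlock.eq_of_nontrivial_inter {B B' : K.Subgraph} (hB : IsBlock B) (hB' : IsBlock B')
    (h : (B.verts ∩ B'.verts).Nontrivial) : B = B' :=
  (hB.eq_of_le (hB.prop.sup hB'.prop h) le_sup_left).trans
    (hB'.eq_of_le (hB.prop.sup hB'.prop h) le_sup_right).symm

theorem IsBlock.exists_walk {B : K.Subgraph} (hB : IsBlock B) {a b : W} (ha : a ∈ B.verts)
    (hb : b ∈ B.verts) : ∃ q : K.Walk a b, ∀ w ∈ q.support, w ∈ B.verts := by
  obtain ⟨q, hq⟩ :=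
    ((Subgraph.connected_iff_forall_exists_walk_subgraph _).1 hB.prop.1).2 ha hb
  exact ⟨q, fun w hw => hq.1 (q.mem_verts_toSubgraph.2 hw)⟩

theorem IsBlock.adj_of_walk {B : K.Subgraph} (hB : IsBlock B) {a b x : W}
    (ha : a ∈ B.verts) (hb : b ∈ B.verts) (hax : K.Adj a x) (q : K.Walk x b)
    (hq : a ∉ q.support) : B.Adj a x := by
  classical
  have hp : (Walk.cons hax q.bypass).IsPath :=
    (Walk.cons_isPath_iff _ _).2
      ⟨q.bypass_isPath, fun h => hq (q.support_bypass_subset_support h)⟩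
  exact (hB.path_le ha hb hp).2 (by simp)

theorem IsBlock.adj {B : K.Subgraph} (hB : IsBlock B) {a b : W}
    (ha : a ∈ B.verts) (hb : b ∈ B.verts) (hab : K.Adj a b) : B.Adj a b :=
  hB.adj_of_walk ha hb hab Walk.nil (by simpa using hab.ne)

/-- The walk `p` leads from a vertex of `B` to a vertex of `B'` and meets either subgraph in that
end only; for a path this is what is usually called a `B`-`B'`-path. -/
structure Joins (B B' : K.Subgraph) {z z' : W} (p : K.Walk z z') : Prop where
  start_mem : z ∈ B.verts
  end_mem : z' ∈ B'.verts
  eq_start : ∀ w ∈ p.support, w ∈ B.verts → w = z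
  eq_end : ∀ w ∈ p.support, w ∈ B'.verts → w = z'

variable {B B' : K.Subgraph} {z z' : W} {p : K.Walk z z'}

theorem Joins.reverse (h : Joins B B' p) : Joins B' B p.reverse where
  start_mem := h.end_mem
  end_mem := h.start_mem
  eq_start w hw := h.eq_end w (by simpa using hw)
  eq_end w hw := h.eq_start w (by simpa using hw)

theorem Joins.bypass [DecidableEq W] (h : Joins B B' p) : Joins B B' p.bypass where
  start_mem := h.start_mem
  end_mem := h.end_mem
  eq_start w hw := h.eq_start w (p.support_bypass_subset_support hw)
  eq_end w hw := h.eq_end w (p.support_bypass_subset_support hw)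

theorem Joins.inter_verts_subset (hj : Joins B B' p) (hB : IsBlock B) (hB' : IsBlock B')
    (hne : B ≠ B') : B.verts ∩ B'.verts ⊆ {z} := by
  classical
  rintro y ⟨hy, hy'⟩
  by_contra hyz
  obtain ⟨p, hp, hj⟩ : ∃ p : K.Walk z z', p.IsPath ∧ Joins B B' p :=
    ⟨p.bypass, p.bypass_isPath, hj.bypass⟩
  obtain ⟨q, hq⟩ := hB'.exists_walk hj.end_mem hy'
  cases p with
  | nil =>
    exact hne (hB.eq_of_nontrivial_inter hB'
      ⟨z, ⟨hj.start_mem, hj.end_mem⟩, y, ⟨hy, hy'⟩, Ne.symm hyz⟩)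
  | @cons _ x _ hzx r =>
    have hzr : z ∉ r.support := ((Walk.cons_isPath_iff _ _).1 hp).2
    have hzq : z ∉ q.support := fun hz =>
      hzr (hj.eq_end z (Walk.start_mem_support _) (hq z hz) ▸ r.end_mem_support)
    have hBzx : B.Adj z x := hB.adj_of_walk hj.start_mem hy hzx (r.append q)
      (by simp [Walk.mem_support_append_iff, hzr, hzq])
    exact hzx.ne' (hj.eq_start x (by simp) (B.edge_vert hBzx.symm))

theorem Joins.exists_walk_meeting_only_start (hj : Joins B B' p) (hB : IsBlock B)
    (hB' : IsBlock B') (hne : B ≠ B') {y : W} (hy : y ∈ B'.verts ∨ y ∈ p.support) :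
    ∃ q : K.Walk z y, ∀ w ∈ q.support, w ∈ B.verts → w = z := by
  classical
  rcases hy with hy | hy
  · obtain ⟨q, hq⟩ := hB'.exists_walk hj.end_mem hy
    refine ⟨p.append q, fun w hw hwB => ?_⟩
    rcases (Walk.mem_support_append_iff _ _).1 hw with hw | hw
    · exact hj.eq_start w hw hwB
    · exact hj.inter_verts_subset hB hB' hne ⟨hwB, hq w hw⟩
  · exact ⟨p.takeUntil y hy,
      fun w hw => hj.eq_start w (p.support_takeUntil_subset_support hy hw)⟩

end Blocks

section Sides

variable {X : Type*} [TopologicalSpace X] {k k' R R' : Set X}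

theorem closure_connectedComponentIn_compl_subset (k : Set X) (x : X) :
    closure (connectedComponentIn kᶜ x) ⊆ connectedComponentIn kᶜ x ∪ k := by
  intro y hy
  by_cases hyk : y ∈ k
  · exact Or.inr hyk
  have hx : x ∈ kᶜ := connectedComponentIn_nonempty_iff.1 (closure_nonempty_iff.1 ⟨y, hy⟩)
  have hpre : IsPreconnected (insert y (connectedComponentIn kᶜ x)) :=
    isPreconnected_connectedComponentIn.subset_closure (Set.subset_insert _ _)
      (Set.insert_subset hy subset_closure)
  exact Or.inl (hpre.subset_connectedComponentIn
    (Set.mem_insert_of_mem _ (mem_connectedComponentIn hx))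
    (Set.insert_subset hyk (connectedComponentIn_subset _ _)) (Set.mem_insert _ _))

theorem closure_connectedComponentIn_compl_inter_nonempty [LocallyConnectedSpace X]
    [PreconnectedSpace X] (hk : IsClosed k) (hne : k.Nonempty) {x : X} (hx : x ∉ k) :
    (closure (connectedComponentIn kᶜ x) ∩ k).Nonempty := by
  have hU : connectedComponentIn kᶜ x ≠ Set.univ := by
    intro h
    obtain ⟨y, hy⟩ := hne
    exact connectedComponentIn_subset kᶜ x (h ▸ Set.mem_univ y) hy
  obtain ⟨y, hy, hyU⟩ := nonempty_frontier_iff.2 ⟨⟨x, mem_connectedComponentIn hx⟩, hU⟩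
  rw [hk.isOpen_compl.connectedComponentIn.interior_eq] at hyU
  exact ⟨y, hy, (closure_connectedComponentIn_compl_subset k x hy).resolve_left hyU⟩

/-- `R` is a side of `k`: a union of connected components of the complement of `k`. For a closed
curve this covers both the interior and the exterior. -/
structure IsSideOf (R k : Set X) : Prop where
  subset_compl : R ⊆ kᶜ
  connectedComponentIn_subset : ∀ x ∈ R, connectedComponentIn kᶜ x ⊆ R

theorem IsSideOf.subset_of_isPreconnected (h : IsSideOf R k) {s : Set X} (hs : IsPreconnected s)
    (hsk : Disjoint s k) {x : X} (hxs : x ∈ s) (hxR : x ∈ R) : s ⊆ R :=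
  (hs.subset_connectedComponentIn hxs (Set.subset_compl_iff_disjoint_right.2 hsk)).trans
    (h.connectedComponentIn_subset x hxR)

theorem IsSideOf.subset [LocallyConnectedSpace X] [PreconnectedSpace X] (hR : IsSideOf R k)
    (hR' : IsSideOf R' k') (hk : IsClosed k) (hne : k.Nonempty) (hkR' : k ⊆ R')
    (hRk' : Disjoint R k') : R ⊆ R' := by
  intro x hx
  obtain ⟨y, hy, hyk⟩ :=
    closure_connectedComponentIn_compl_inter_nonempty hk hne (hR.subset_compl hx)
  have hdisj : Disjoint (closure (connectedComponentIn kᶜ x)) k' :=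
    (Set.disjoint_union_left.2 ⟨hRk'.mono_left (hR.connectedComponentIn_subset x hx),
      Set.subset_compl_iff_disjoint_right.1 (hkR'.trans hR'.subset_compl)⟩).mono_left
      (closure_connectedComponentIn_compl_subset k x)
  exact hR'.subset_of_isPreconnected isPreconnected_connectedComponentIn.closure hdisj hy
    (hkR' hyk) (subset_closure (mem_connectedComponentIn (hR.subset_compl hx)))

variable [Bornology X]

/-- The union of the bounded components of the complement of `k`; for a closed curve, its
interior. -/
def inside (k : Set X) : Set X :=
  {x | x ∉ k ∧ Bornology.IsBounded (connectedComponentIn kᶜ x)}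

/-- The union of the unbounded components of the complement of `k`; for a closed curve, its
exterior. -/
def outside (k : Set X) : Set X :=
  {x | x ∉ k ∧ ¬ Bornology.IsBounded (connectedComponentIn kᶜ x)}

theorem isSideOf_inside (k : Set X) : IsSideOf (inside k) k where
  subset_compl _ hx := hx.1
  connectedComponentIn_subset _ hx _ hy :=
    ⟨connectedComponentIn_subset _ _ hy, connectedComponentIn_eq hy ▸ hx.2⟩

theorem isSideOf_outside (k : Set X) : IsSideOf (outside k) k where
  subset_compl _ hx := hx.1
  connectedComponentIn_subset _ hx _ hy :=
    ⟨connectedComponentIn_subset _ _ hy, connectedComponentIn_eq hy ▸ hx.2⟩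

theorem disjoint_inside_outside (k : Set X) : Disjoint (inside k) (outside k) :=
  Set.disjoint_left.2 fun _ hx hx' => hx'.2 hx.2

theorem outside_anti (h : k ⊆ k') : outside k' ⊆ outside k := fun x hx =>
  ⟨fun hxk => hx.1 (h hxk), fun hb =>
    hx.2 (hb.subset (connectedComponentIn_mono x (Set.compl_subset_compl.2 h)))⟩

end Sides

section NormedSides

variable {E : Type*} [NormedAddCommGroup E] [NormedSpace ℝ E] [Nontrivial E] {k k' : Set E}

theorem outside_nonempty (hk : Bornology.IsBounded k) : (outside k).Nonempty := by
  obtain ⟨r, hr, hkr⟩ := hk.subset_ball_lt 0 0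
  obtain ⟨e, he⟩ := exists_norm_eq E zero_le_one
  have hnorm : ∀ t ∈ Set.Ici r, ‖t • e‖ = t := fun t ht => by
    rw [norm_smul, he, mul_one, Real.norm_of_nonneg (hr.le.trans ht)]
  set ray : Set E := (fun t : ℝ => t • e) '' Set.Ici r
  have hray : ray ⊆ kᶜ := by
    rintro _ ⟨t, ht, rfl⟩ hmem
    have hlt : ‖t • e‖ < r := mem_ball_zero_iff.1 (hkr hmem)
    exact hlt.not_ge ((hnorm t ht).symm ▸ ht)
  have hstart : r • e ∈ ray := ⟨r, Set.self_mem_Ici, rfl⟩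
  have hpre : IsPreconnected ray := isPreconnected_Ici.image _ (by fun_prop)
  refine ⟨r • e, hray hstart, fun hb => ?_⟩
  obtain ⟨M, hM⟩ := (hb.subset (hpre.subset_connectedComponentIn hstart hray)).exists_norm_le
  have hfar : max r (M + 1) ∈ Set.Ici r := Set.mem_Ici.2 (le_max_left _ _)
  have hle : max r (M + 1) ≤ M := hnorm _ hfar ▸ hM _ ⟨_, hfar, rfl⟩
  linarith [le_max_right r (M + 1)]

theorem not_subset_inside_of_subset_inside (hk : IsCompact k) (hk' : Bornology.IsBounded k')
    (hne : k.Nonempty) (h : k ⊆ inside k') : ¬ k' ⊆ inside k := by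
  intro h'
  have hsub : outside k ⊆ inside k' := (isSideOf_outside k).subset (isSideOf_inside k')
    hk.isClosed hne h ((disjoint_inside_outside k).symm.mono_right h')
  obtain ⟨x, hx⟩ := outside_nonempty (hk.isBounded.union hk')
  exact Set.disjoint_left.1 (disjoint_inside_outside k')
    (hsub (outside_anti Set.subset_union_left hx)) (outside_anti Set.subset_union_right hx)

end NormedSides

namespace Drawing

open SimpleGraph

variable {V : Type*} {G : SimpleGraph V} {D : Drawing G}

section Crossings

theorem CrossAt.swap {d d' : G.Dart} {x : Plane} (h : D.CrossAt d d' x) : D.CrossAt d' d x :=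
  ⟨h.1.symm, h.2.2.1, h.2.1, h.2.2.2⟩

theorem CrossAt.of_edge_eq {d e d' : G.Dart} {x : Plane} (h : D.CrossAt e d' x)
    (hde : d.edge = e.edge) : D.CrossAt d d' x := by
  rcases (dart_edge_eq_iff d e).1 hde with rfl | rfl
  · exact h
  · exact CrossAt.symm_left D (by rwa [Dart.symm_symm])

theorem Crossing.ne_pos (x : D.Crossing) (v : V) : x.1 ≠ D.pos v := by
  obtain ⟨_, _, h⟩ := x.2
  exact h.2.2.2 v

theorem Crossing.exists_crossAt (x : D.Crossing) {d : G.Dart} (h : x.1 ∈ Set.range (D.arc d)) :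
    ∃ e, D.CrossAt d e x.1 := by
  obtain ⟨e, e', he⟩ := x.2
  by_cases hd : d.edge = e.edge
  · exact ⟨e', he.of_edge_eq hd⟩
  · exact ⟨e, hd, h, he.2.1, he.2.2.2⟩

theorem IsOnePlanar.dart_eq_of_mem_range (hD : D.IsOnePlanar) {e e' d : G.Dart} {x : Plane}
    (he : D.CrossAt e e' x) (hd : x ∈ Set.range (D.arc d)) :
    (d = e ∨ d = e.symm) ∨ d = e' ∨ d = e'.symm := by
  simp only [← dart_edge_eq_iff]
  by_contra! hne
  exact hne.2 (hD.at_most_one _ _ _ _ _ ⟨hne.1.symm, he.2.1, hd, he.2.2.2⟩ he).1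

theorem IsOnePlanar.finite_darts_through (hD : D.IsOnePlanar) (x : D.Crossing) :
    {d : G.Dart | x.1 ∈ Set.range (D.arc d)}.Finite := by
  obtain ⟨e, e', he⟩ := x.2
  refine (Set.toFinite {e, e.symm, e', e'.symm}).subset fun d hd => ?_
  simpa [or_assoc] using hD.dart_eq_of_mem_range he hd

theorem IsCircular.exists_walk_avoiding_crossing (hcirc : D.IsCircular) (hD : D.IsOnePlanar)
    (x : D.Crossing) {a b : V} (ha : D.planarization.Adj (Sum.inl a) (Sum.inr x))
    (hb : D.planarization.Adj (Sum.inl b) (Sum.inr x)) :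
    ∃ q : D.planarization.Walk (Sum.inl a) (Sum.inl b), Sum.inr x ∉ q.support := by
  obtain ⟨e, e', he⟩ := x.2
  obtain ⟨_, _, _, -, -, h₁, h₂, h₃, h₄, h₅, h₆, -⟩ := hcirc _ _ _ he
  have to_snd : ∃ q : D.planarization.Walk (Sum.inl e.fst) (Sum.inl e.snd),
      Sum.inr x ∉ q.support :=
    ⟨Walk.cons h₁ (Walk.cons h₂ (Walk.cons h₃ (Walk.cons h₄ Walk.nil))), by simp⟩
  have to_snd' : ∃ q : D.planarization.Walk (Sum.inl e.fst) (Sum.inl e'.snd),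
      Sum.inr x ∉ q.support :=
    ⟨Walk.cons h₁ (Walk.cons h₂ (Walk.cons h₃ (Walk.cons h₄ (Walk.cons h₅
      (Walk.cons h₆ Walk.nil))))), by simp⟩
  have from_fst : ∀ a : V, D.planarization.Adj (Sum.inl a) (Sum.inr x) →
      ∃ q : D.planarization.Walk (Sum.inl e.fst) (Sum.inl a), Sum.inr x ∉ q.support := by
    rintro _ ⟨d, rfl, hd⟩
    rcases hD.dart_eq_of_mem_range he hd with (rfl | rfl) | rfl | rfl
    · exact ⟨Walk.nil, by simp⟩
    · exact to_snd
    · exact ⟨Walk.cons h₁ (Walk.cons h₂ Walk.nil), by simp⟩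
    · exact to_snd'
  obtain ⟨p, hp⟩ := from_fst a ha
  obtain ⟨q, hq⟩ := from_fst b hb
  exact ⟨p.reverse.append q, by simp [Walk.mem_support_append_iff, hp, hq]⟩

end Crossings

section Curves

theorem mem_range_of_mem_halfEdge {u : V} {x : D.Crossing} {y : Plane} (h : y ∈ D.halfEdge u x) :
    ∃ d : G.Dart, x.1 ∈ Set.range (D.arc d) ∧ y ∈ Set.range (D.arc d) := by
  obtain ⟨d, s, t, -, ht, -, hs⟩ := h
  exact ⟨d, ⟨t, ht⟩, ⟨s, hs⟩⟩

theorem pos_mem_halfEdge {u : V} {x : D.Crossing}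
    (h : D.planarization.Adj (Sum.inl u) (Sum.inr x)) : D.pos u ∈ D.halfEdge u x := by
  obtain ⟨d, rfl, t, ht⟩ := h
  exact ⟨d, 0, t, rfl, ht, unitInterval.nonneg', (D.arc d).source⟩

theorem crossing_mem_halfEdge {u : V} {x : D.Crossing}
    (h : D.planarization.Adj (Sum.inl u) (Sum.inr x)) : x.1 ∈ D.halfEdge u x := by
  obtain ⟨d, rfl, t, ht⟩ := h
  exact ⟨d, t, t, rfl, ht, le_rfl, ht⟩

theorem isPreconnected_halfEdge (u : V) (x : D.Crossing) : IsPreconnected (D.halfEdge u x) := by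
  refine isPreconnected_of_forall (D.pos u) ?_
  rintro _ ⟨d, s, t, rfl, ht, hst, rfl⟩
  refine ⟨D.arc d '' Set.Iic t, ?_, ⟨0, unitInterval.nonneg', (D.arc d).source⟩,
    ⟨s, hst, rfl⟩, isPreconnected_Iic.image _ (D.arc d).continuous.continuousOn⟩
  rintro _ ⟨r, hr, rfl⟩
  exact ⟨d, r, t, rfl, ht, hr, rfl⟩

theorem isCompact_halfEdge (hD : D.IsOnePlanar) (u : V) (x : D.Crossing) :
    IsCompact (D.halfEdge u x) := by
  have hunion : D.halfEdge u x = ⋃ d ∈ {d : G.Dart | x.1 ∈ Set.range (D.arc d) ∧ d.fst = u},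
      (fun q : unitInterval × unitInterval => D.arc d q.1) ''
        {q | D.arc d q.2 = x.1 ∧ q.1 ≤ q.2} := by
    ext y
    simp only [Set.mem_iUnion, Set.mem_image, Prod.exists, exists_prop, Set.mem_ofPred_eq]
    constructor
    · rintro ⟨d, s, t, hd, ht, hst, hs⟩
      exact ⟨d, ⟨⟨t, ht⟩, hd⟩, s, t, ⟨ht, hst⟩, hs⟩
    · rintro ⟨d, ⟨-, hd⟩, s, t, ⟨ht, hst⟩, hs⟩
      exact ⟨d, s, t, hd, ht, hst, hs⟩
  rw [hunion]
  refine ((hD.finite_darts_through x).subset fun d hd => hd.1).isCompact_biUnion fun d _ => ?_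
  have hclosed : IsClosed {q : unitInterval × unitInterval | D.arc d q.2 = x.1 ∧ q.1 ≤ q.2} :=
    (isClosed_singleton.preimage ((D.arc d).continuous.comp continuous_snd)).inter
      (isClosed_le (α := unitInterval) continuous_fst continuous_snd)
  exact hclosed.isCompact.image ((D.arc d).continuous.comp continuous_fst)

theorem eq_of_pos_mem_halfEdge {u w : V} {x : D.Crossing} (h : D.pos w ∈ D.halfEdge u x) :
    w = u := by
  obtain ⟨d, s, t, rfl, ht, hst, hs⟩ := h
  rcases D.eq_end_of_mem d w ⟨s, hs⟩ with rfl | rfl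
  · rfl
  · have hs1 : s = 1 := D.arc_injective d (hs.trans (D.arc d).target.symm)
    have ht1 : t = 1 := le_antisymm unitInterval.le_one' (hs1 ▸ hst)
    exact absurd (ht.symm.trans (ht1 ▸ (D.arc d).target)) (x.ne_pos _)

theorem isPreconnected_curve (a b : D.PVertex) : IsPreconnected (D.curve a b) := by
  rcases a with a | a <;> rcases b with b | b
  · refine isPreconnected_of_forall_pair ?_
    rintro y ⟨d, rfl, rfl, hy⟩ y' ⟨d', hfst, hsnd, hy'⟩
    obtain rfl : d' = d := Dart.ext _ _ (Prod.ext hfst hsnd)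
    exact ⟨_, fun z hz => ⟨d', rfl, rfl, hz⟩, hy, hy', isPreconnected_range (D.arc d').continuous⟩
  · exact isPreconnected_halfEdge _ _
  · exact isPreconnected_halfEdge _ _
  · exact isPreconnected_empty

theorem point_left_mem_curve {a b : D.PVertex} (h : D.planarization.Adj a b) :
    D.point a ∈ D.curve a b := by
  rcases a with a | a <;> rcases b with b | b
  · obtain ⟨d, rfl, rfl, -⟩ := h
    exact ⟨d, rfl, rfl, 0, (D.arc d).source⟩
  · exact pos_mem_halfEdge h
  · exact crossing_mem_halfEdge h.symm
  · exact h.elim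

theorem point_right_mem_curve {a b : D.PVertex} (h : D.planarization.Adj a b) :
    D.point b ∈ D.curve a b := by
  rcases a with a | a <;> rcases b with b | b
  · obtain ⟨d, rfl, rfl, -⟩ := h
    exact ⟨d, rfl, rfl, 1, (D.arc d).target⟩
  · exact crossing_mem_halfEdge h
  · exact pos_mem_halfEdge h.symm
  · exact h.elim

theorem eq_or_eq_of_pos_mem_curve {a b : D.PVertex} {w : V} (h : D.pos w ∈ D.curve a b) :
    Sum.inl w = a ∨ Sum.inl w = b := by
  rcases a with a | a <;> rcases b with b | b
  · obtain ⟨d, rfl, rfl, hd⟩ := h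
    exact (D.eq_end_of_mem d w hd).imp (congrArg Sum.inl) (congrArg Sum.inl)
  · exact Or.inl (congrArg Sum.inl (eq_of_pos_mem_halfEdge h))
  · exact Or.inr (congrArg Sum.inl (eq_of_pos_mem_halfEdge h))
  · exact h.elim

theorem IsOnePlanar.exists_dart_of_mem_curve (hD : D.IsOnePlanar) {a b : D.PVertex} {y : Plane}
    (hab : D.planarization.Adj a b) (hy : y ∈ D.curve a b) :
    ∃ d : G.Dart, y ∈ Set.range (D.arc d) ∧
      ∀ (d' : G.Dart) (x : D.Crossing), D.CrossAt d d' x.1 → Sum.inr x = a ∨ Sum.inr x = b := by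
  have half : ∀ {u : V} {c : D.Crossing}, y ∈ D.halfEdge u c → ∃ d : G.Dart,
      y ∈ Set.range (D.arc d) ∧ ∀ (d' : G.Dart) (x : D.Crossing), D.CrossAt d d' x.1 → x = c := by
    intro u c hy
    obtain ⟨d, hdc, hdy⟩ := mem_range_of_mem_halfEdge hy
    obtain ⟨e, he⟩ := c.exists_crossAt hdc
    exact ⟨d, hdy, fun d' x hx => Subtype.ext (hD.at_most_one _ _ _ _ _ hx he).2⟩
  rcases a with a | a <;> rcases b with b | b
  · obtain ⟨d, rfl, rfl, hdy⟩ := hy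
    obtain ⟨d', hfst, hsnd, hfree⟩ := hab
    obtain rfl : d' = d := Dart.ext _ _ (Prod.ext hfst hsnd)
    exact ⟨d', hdy, fun e x hx => absurd hx (hfree e x.1)⟩
  · obtain ⟨d, hdy, hd⟩ := half hy
    exact ⟨d, hdy, fun e x hx => Or.inr (congrArg Sum.inr (hd e x hx))⟩
  · obtain ⟨d, hdy, hd⟩ := half hy
    exact ⟨d, hdy, fun e x hx => Or.inl (congrArg Sum.inr (hd e x hx))⟩
  · exact hab.elim

theorem IsOnePlanar.disjoint_curve_halfEdge (hD : D.IsOnePlanar) {a b : D.PVertex} {u : V}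
    {x : D.Crossing} (hab : D.planarization.Adj a b) (hau : a ≠ Sum.inl u) (hbu : b ≠ Sum.inl u)
    (hax : a ≠ Sum.inr x) (hbx : b ≠ Sum.inr x) : Disjoint (D.curve a b) (D.halfEdge u x) := by
  refine Set.disjoint_left.2 fun y hy hyx => ?_
  by_cases hpos : ∃ w, y = D.pos w
  · obtain ⟨w, rfl⟩ := hpos
    obtain rfl := eq_of_pos_mem_halfEdge hyx
    exact (eq_or_eq_of_pos_mem_curve hy).elim hau.symm hbu.symm
  push Not at hpos
  obtain ⟨d, hdy, hd⟩ := hD.exists_dart_of_mem_curve hab hy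
  suffices ∃ d', D.CrossAt d d' x.1 by
    obtain ⟨d', hd'⟩ := this
    exact (hd d' x hd').elim hax.symm hbx.symm
  obtain ⟨e, hex, hey⟩ := mem_range_of_mem_halfEdge hyx
  obtain ⟨f, hf⟩ := x.exists_crossAt hex
  by_cases hde : d.edge = e.edge
  · exact ⟨f, hf.of_edge_eq hde⟩
  · have hcross : D.CrossAt d e y := ⟨hde, hdy, hey, hpos⟩
    have hyx : y = x.1 := (hD.at_most_one _ _ _ _ _ hcross.swap hf).2
    exact ⟨e, hyx ▸ hcross⟩

theorem carrier_mono {H H' : D.planarization.Subgraph} (h : H ≤ H') :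
    D.carrier H ⊆ D.carrier H' := by
  rintro y (⟨a, ha, hy⟩ | ⟨a, b, hab, hy⟩)
  · exact Or.inl ⟨a, h.1 ha, hy⟩
  · exact Or.inr ⟨a, b, h.2 hab, hy⟩

end Curves

section Paths

variable {H H' : D.planarization.Subgraph} {R R' : Set Plane} {a b c : D.PVertex}
  {E : Set D.PVertex}

theorem HasPathIn.of_walk (p : D.planarization.Walk a b) (hH : p.toSubgraph ≤ H)
    (hR : ∀ w ∈ p.support, w ∉ E → D.point w ∈ R) : D.HasPathIn H R a b E := by
  classical
  exact ⟨p.bypass, p.bypass_isPath, p.toSubgraph_bypass_le_toSubgraph.trans hH,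
    fun w hw => hR w (p.support_bypass_subset_support hw)⟩

theorem HasPathIn.symm (h : D.HasPathIn H R a b E) : D.HasPathIn H R b a E := by
  obtain ⟨p, hp, hpH, hpR⟩ := h
  exact ⟨p.reverse, hp.reverse, by rwa [Walk.toSubgraph_reverse],
    fun w hw => hpR w (by simpa using hw)⟩

theorem HasPathIn.trans (h : D.HasPathIn H R a b E) (h' : D.HasPathIn H R b c E) :
    D.HasPathIn H R a c E := by
  obtain ⟨p, -, hpH, hpR⟩ := h
  obtain ⟨q, -, hqH, hqR⟩ := h'
  refine .of_walk (p.append q) (by rw [Walk.toSubgraph_append]; exact sup_le hpH hqH) fun w hw => ?_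
  exact ((Walk.mem_support_append_iff _ _).1 hw).elim (hpR w) (hqR w)

theorem HasPathIn.mono {E' : Set D.PVertex} (h : D.HasPathIn H R a b E) (hH : H ≤ H')
    (hR : ∀ w ∈ H.verts, D.point w ∈ R → D.point w ∈ R') (hE : E ⊆ E') :
    D.HasPathIn H' R' a b E' := by
  obtain ⟨p, hp, hpH, hpR⟩ := h
  exact ⟨p, hp, hpH.trans hH, fun w hw hwE =>
    hR w (hpH.1 (p.mem_verts_toSubgraph.2 hw)) (hpR w hw fun h => hwE (hE h))⟩

end Paths

namespace Quad

variable {C C' : D.Quad} {H B B' : D.planarization.Subgraph} {R R' : Set Plane}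

section Curve

/-- The four vertices of the cycle `(u, c, v, s)`, as vertices of the planarization. -/
def vertexSet (C : D.Quad) : Set D.PVertex :=
  {Sum.inl C.u, Sum.inr C.c, Sum.inl C.v, Sum.inr C.s}

theorem IsCycleOf.vertexSet_subset (h : C.IsCycleOf H) : C.vertexSet ⊆ H.verts := by
  rintro _ (rfl | rfl | rfl | rfl)
  exacts [H.edge_vert h.1, H.edge_vert h.2.1, H.edge_vert h.2.2.1, H.edge_vert h.2.2.2]

theorem IsCycleOf.mono {H' : D.planarization.Subgraph} (h : C.IsCycleOf H) (hH : H ≤ H') :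
    C.IsCycleOf H' :=
  ⟨hH.2 h.1, hH.2 h.2.1, hH.2 h.2.2.1, hH.2 h.2.2.2⟩

theorem IsCycleOf.point_mem_curve (h : C.IsCycleOf H) {a : D.PVertex} (ha : a ∈ C.vertexSet) :
    D.point a ∈ C.curve := by
  rcases ha with rfl | rfl | rfl | rfl
  · exact .inl (.inl (.inl (pos_mem_halfEdge h.1.adj_sub)))
  · exact .inl (.inl (.inl (crossing_mem_halfEdge h.1.adj_sub)))
  · exact .inl (.inl (.inr (pos_mem_halfEdge h.2.1.adj_sub.symm)))
  · exact .inr (crossing_mem_halfEdge h.2.2.2.adj_sub.symm)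

theorem IsCycleOf.pos_u_mem_curve (h : C.IsCycleOf H) : D.pos C.u ∈ C.curve :=
  h.point_mem_curve (a := Sum.inl C.u) (by simp [vertexSet])

theorem IsCycleOf.pos_v_mem_curve (h : C.IsCycleOf H) : D.pos C.v ∈ C.curve :=
  h.point_mem_curve (a := Sum.inl C.v) (by simp [vertexSet])

theorem IsCycleOf.exists_adj_of_mem_curve (h : C.IsCycleOf H) {y : Plane} (hy : y ∈ C.curve) :
    ∃ a b, H.Adj a b ∧ y ∈ D.curve a b := by
  rcases hy with ((hy | hy) | hy) | hy
  exacts [⟨_, _, h.1, hy⟩, ⟨_, _, h.2.1, hy⟩, ⟨_, _, h.2.2.1, hy⟩, ⟨_, _, h.2.2.2, hy⟩]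

theorem IsCycleOf.curve_subset_carrier (h : C.IsCycleOf H) : C.curve ⊆ D.carrier H :=
  fun _ hy => Or.inr (h.exists_adj_of_mem_curve hy)

theorem isCompact_curve (hD : D.IsOnePlanar) (C : D.Quad) : IsCompact C.curve :=
  (((isCompact_halfEdge hD _ _).union (isCompact_halfEdge hD _ _)).union
    (isCompact_halfEdge hD _ _)).union (isCompact_halfEdge hD _ _)

theorem isSideOf_interior (C : D.Quad) : IsSideOf C.interior C.curve := isSideOf_inside C.curve

theorem isSideOf_exterior (C : D.Quad) : IsSideOf C.exterior C.curve := isSideOf_outside C.curve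

theorem disjoint_curve_curve (hD : D.IsOnePlanar) {a b : D.PVertex}
    (hab : D.planarization.Adj a b) (ha : a ∉ C.vertexSet) (hb : b ∉ C.vertexSet) :
    Disjoint (D.curve a b) C.curve := by
  simp only [vertexSet, Set.mem_insert_iff, Set.mem_singleton_iff, not_or] at ha hb
  obtain ⟨hau, hac, hav, has⟩ := ha
  obtain ⟨hbu, hbc, hbv, hbs⟩ := hb
  simp only [curve, Set.disjoint_union_right]
  exact ⟨⟨⟨hD.disjoint_curve_halfEdge hab hau hbu hac hbc,
    hD.disjoint_curve_halfEdge hab hav hbv hac hbc⟩,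
    hD.disjoint_curve_halfEdge hab hav hbv has hbs⟩,
    hD.disjoint_curve_halfEdge hab hau hbu has hbs⟩

theorem curve_subset_of_isSideOf (hD : D.IsOnePlanar) (hR : IsSideOf R C.curve)
    {a b : D.PVertex} (hab : D.planarization.Adj a b) (ha : a ∉ C.vertexSet)
    (hb : b ∉ C.vertexSet) (haR : D.point a ∈ R) : D.curve a b ⊆ R :=
  hR.subset_of_isPreconnected (isPreconnected_curve a b) (disjoint_curve_curve hD hab ha hb)
    (point_left_mem_curve hab) haR

theorem point_mem_of_walk (hD : D.IsOnePlanar) (hR : IsSideOf R C.curve) {a b : D.PVertex}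
    (p : D.planarization.Walk a b) (hp : ∀ w ∈ p.support, w ∉ C.vertexSet)
    (ha : D.point a ∈ R) : D.point b ∈ R := by
  induction p with
  | nil => exact ha
  | cons h p ih =>
    have hnext := curve_subset_of_isSideOf hD hR h (hp _ (by simp)) (hp _ (by simp)) ha
      (point_right_mem_curve h)
    exact ih (fun w hw => hp w (by simp [hw])) hnext

theorem IsCycleOf.notMem_vertexSet (h : C.IsCycleOf H) (hR : IsSideOf R C.curve) {a : D.PVertex}
    (ha : D.point a ∈ R) : a ∉ C.vertexSet :=
  fun hmem => hR.subset_compl ha (h.point_mem_curve hmem)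

theorem IsCycleOf.curve_subset (hD : D.IsOnePlanar) (hC : C.IsCycleOf B)
    (hR : IsSideOf R C.curve) (hC' : C'.IsCycleOf B') (h : ∀ y ∈ B'.verts, D.point y ∈ R) :
    C'.curve ⊆ R := by
  intro y hy
  obtain ⟨a, b, hab, hy⟩ := hC'.exists_adj_of_mem_curve hy
  have ha := h a (B'.edge_vert hab)
  have hb := h b (B'.edge_vert hab.symm)
  exact curve_subset_of_isSideOf hD hR hab.adj_sub (hC.notMem_vertexSet hR ha)
    (hC.notMem_vertexSet hR hb) ha hy

end Curve

section Transfer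

theorem NoShortcut.top (h : C.NoShortcut B R) (hB : IsBlock B) (hC : C.IsCycleOf B) :
    C.NoShortcut ⊤ R := by
  have hu := B.edge_vert hC.1
  have hv := B.edge_vert hC.2.2.1
  refine ⟨fun huv => h.1 ⟨hB.adj hu hv huv.1, huv.2⟩, fun c' hc hs hcu hcv => ?_⟩
  refine h.2 c' hc hs (hB.adj_of_walk hu hv hcu (Walk.cons hcv.symm Walk.nil) ?_)
    (hB.adj_of_walk hv hu hcv (Walk.cons hcu.symm Walk.nil) ?_)
  · simpa using C.u_ne_v
  · simpa using C.u_ne_v.symm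

theorem adj_crossing_of_adj_crossing (hD : D.IsOnePlanar) (hcirc : D.IsCircular) (hB : IsBlock B)
    {u x : V} {c : D.Crossing} (hu : B.Adj (Sum.inl u) (Sum.inr c))
    (hx : D.planarization.Adj (Sum.inl x) (Sum.inr c)) : B.Adj (Sum.inl x) (Sum.inr c) := by
  obtain ⟨q, hq⟩ := hcirc.exists_walk_avoiding_crossing hD c hx hu.adj_sub
  exact (hB.adj_of_walk (B.edge_vert hu.symm) (B.edge_vert hu) hx.symm q hq).symm

theorem sideNeighbors_top (hD : D.IsOnePlanar) (hcirc : D.IsCircular) (hB : IsBlock B)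
    (hC : C.IsCycleOf B) : C.sideNeighbors ⊤ R = C.sideNeighbors B R := by
  have adj_iff : ∀ {x : V} {c : D.Crossing}, B.Adj (Sum.inl C.u) (Sum.inr c) →
      ((⊤ : D.planarization.Subgraph).Adj (Sum.inl x) (Sum.inr c) ↔
        B.Adj (Sum.inl x) (Sum.inr c)) :=
    fun hu => ⟨adj_crossing_of_adj_crossing hD hcirc hB hu, fun hx => hx.adj_sub⟩
  ext x
  simp only [sideNeighbors, Set.mem_ofPred_eq, adj_iff hC.1, adj_iff hC.2.2.2.symm]

theorem NoCommonFace.mono {H' : D.planarization.Subgraph} (h : C.NoCommonFace H R) (hH : H ≤ H')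
    (hR : IsSideOf R C.curve) (hC : C.IsCycleOf H) : C.NoCommonFace H' R := by
  rintro ⟨f, ⟨x, hx, rfl⟩, hfR, hu, hv⟩
  have hcompl : (D.carrier H')ᶜ ⊆ (D.carrier H)ᶜ := Set.compl_subset_compl.2 (carrier_mono hH)
  have hface : connectedComponentIn (D.carrier H)ᶜ x ⊆ C.curveᶜ :=
    (connectedComponentIn_subset _ _).trans (Set.compl_subset_compl.2 hC.curve_subset_carrier)
  have hfrontier : ∀ y ∈ C.curve, y ∈ frontier (connectedComponentIn (D.carrier H')ᶜ x) →
      y ∈ frontier (connectedComponentIn (D.carrier H)ᶜ x) := fun y hy hyf =>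
    ⟨closure_mono (connectedComponentIn_mono x hcompl) hyf.1,
      fun hyi => hface (interior_subset hyi) hy⟩
  refine h ⟨_, ⟨x, hcompl hx, rfl⟩, ?_, hfrontier _ hC.pos_u_mem_curve hu,
    hfrontier _ hC.pos_v_mem_curve hv⟩
  exact hR.subset_of_isPreconnected isPreconnected_connectedComponentIn
    (Set.subset_compl_iff_disjoint_right.1 hface) (mem_connectedComponentIn (hcompl hx))
    (hfR (mem_connectedComponentIn hx))

/-- The common form of posi-cycles (`R` the interior, `R'` the exterior) and of nega-cycles
(`R` the exterior, `R'` the interior). -/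
def IsHardOn (H : D.planarization.Subgraph) (C : D.Quad) (R R' : Set Plane) : Prop :=
  C.IsCycleOf H ∧ C.NoShortcut H R ∧ (C.sideNeighbors H R').encard ≤ 1 ∧ C.NoCommonFace H R

theorem isPosi_iff : C.IsPosi H ↔ IsHardOn H C C.interior C.exterior := by
  simp only [IsPosi, IsBCycle, IsWCycle, IsCandidatePosi, IsHardOn, Set.encard_le_one_iff_eq,
    Set.encard_eq_one]
  tauto

theorem isNega_iff : C.IsNega H ↔ IsHardOn H C C.exterior C.interior :=
  and_assoc

theorem IsHardOn.top (hD : D.IsOnePlanar) (hcirc : D.IsCircular) (hB : IsBlock B)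
    (hR : IsSideOf R C.curve) (h : IsHardOn B C R R') : IsHardOn ⊤ C R R' := by
  obtain ⟨hC, hshort, hside, hface⟩ := h
  exact ⟨hC.mono le_top, hshort.top hB hC, (sideNeighbors_top hD hcirc hB hC).symm ▸ hside,
    hface.mono le_top hR hC⟩

theorem IsPosi.top (hD : D.IsOnePlanar) (hcirc : D.IsCircular) (hB : IsBlock B)
    (h : C.IsPosi B) : C.IsPosi ⊤ :=
  isPosi_iff.2 ((isPosi_iff.1 h).top hD hcirc hB C.isSideOf_interior)

theorem IsNega.top (hD : D.IsOnePlanar) (hcirc : D.IsCircular) (hB : IsBlock B)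
    (h : C.IsNega B) : C.IsNega ⊤ :=
  isNega_iff.2 ((isNega_iff.1 h).top hD hcirc hB C.isSideOf_exterior)

theorem IsPosi.isCycleOf (h : C.IsPosi H) : C.IsCycleOf H := (isPosi_iff.1 h).1

theorem IsNega.isCycleOf (h : C.IsNega H) : C.IsCycleOf H := h.1.1

end Transfer

section Linking

/-- `C` is a cycle of `B` with a side `R` in which `z` reaches `u` and `v` by paths of `B`; the
common form of the in-factors of posi-cycles and of nega-cycles. -/
structure ReachedIn (B : D.planarization.Subgraph) (C : D.Quad) (R : Set Plane) (z : D.PVertex) :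
    Prop where
  isCycleOf : C.IsCycleOf B
  isSideOf : IsSideOf R C.curve
  path_u : D.HasPathIn B R z (Sum.inl C.u) {Sum.inl C.u}
  path_v : D.HasPathIn B R z (Sum.inl C.v) {Sum.inl C.v}

theorem HasInFactor.isPosi_or_isNega {z : V} (h : HasInFactor B C z) :
    (C.IsPosi B ∧ ReachedIn B C C.exterior (Sum.inl z)) ∨
      (C.IsNega B ∧ ReachedIn B C C.interior (Sum.inl z)) :=
  h.imp (fun ⟨hC, hu, hv⟩ => ⟨hC, hC.isCycleOf, C.isSideOf_exterior, hu, hv⟩)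
    fun ⟨hC, hu, hv⟩ => ⟨hC, hC.isCycleOf, C.isSideOf_interior, hu, hv⟩

variable {z z' : D.PVertex} {p : D.planarization.Walk z z'}

theorem ReachedIn.point_mem (h : ReachedIn B C R z) : D.point z ∈ R := by
  obtain ⟨p, -, -, hp⟩ := h.path_u
  obtain ⟨q, -, -, hq⟩ := h.path_v
  by_cases hz : z = Sum.inl C.u
  · exact hq z q.start_mem_support (by simpa [hz] using C.u_ne_v)
  · exact hp z p.start_mem_support hz

theorem ReachedIn.point_mem_of_joins (hD : D.IsOnePlanar) (hB : IsBlock B) (hB' : IsBlock B')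
    (hne : B ≠ B') (hj : Joins B B' p) (h : ReachedIn B C R z) {y : D.PVertex}
    (hy : y ∈ B'.verts ∨ y ∈ p.support) : D.point y ∈ R := by
  obtain ⟨q, hq⟩ := hj.exists_walk_meeting_only_start hB hB' hne hy
  refine point_mem_of_walk hD h.isSideOf q (fun w hw hwC => ?_) h.point_mem
  obtain rfl := hq w hw (h.isCycleOf.vertexSet_subset hwC)
  exact h.isCycleOf.notMem_vertexSet h.isSideOf h.point_mem hwC

/-- Either cycle is drawn on the given side of the other one, and `H` has paths from `u` to `u'`
and from `v` to `v'` on both sides: all that a forbidden cycle pair requires beyond its two cycles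
being posi- or nega-cycles. -/
structure Linked (H : D.planarization.Subgraph) (C C' : D.Quad) (R R' : Set Plane) : Prop where
  curve_left : C.curve ⊆ R'
  curve_right : C'.curve ⊆ R
  path_u : D.HasPathIn H (R ∩ R') (Sum.inl C.u) (Sum.inl C'.u) {Sum.inl C.u, Sum.inl C'.u}
  path_v : D.HasPathIn H (R ∩ R') (Sum.inl C.v) (Sum.inl C'.v) {Sum.inl C.v, Sum.inl C'.v}

theorem Linked.symm (h : Linked H C C' R R') : Linked H C' C R' R where
  curve_left := h.curve_right
  curve_right := h.curve_left
  path_u := by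
    rw [Set.inter_comm, Set.pair_comm]
    exact h.path_u.symm
  path_v := by
    rw [Set.inter_comm, Set.pair_comm]
    exact h.path_v.symm

theorem ReachedIn.linked (hD : D.IsOnePlanar) (hB : IsBlock B) (hB' : IsBlock B') (hne : B ≠ B')
    (hj : Joins B B' p) (h : ReachedIn B C R z) (h' : ReachedIn B' C' R' z') :
    Linked ⊤ C C' R R' := by
  have mem_R : ∀ y, y ∈ B'.verts ∨ y ∈ p.support → D.point y ∈ R :=
    fun _ hy => h.point_mem_of_joins hD hB hB' hne hj hy
  have mem_R' : ∀ y, y ∈ B.verts ∨ y ∈ p.support → D.point y ∈ R' :=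
    fun _ hy => h'.point_mem_of_joins hD hB' hB hne.symm hj.reverse (by simpa using hy)
  have link : ∀ {a a' : D.PVertex}, D.HasPathIn B R z a {a} → D.HasPathIn B' R' z' a' {a'} →
      D.HasPathIn ⊤ (R ∩ R') a a' {a, a'} := by
    intro a a' ha ha'
    have ha : D.HasPathIn ⊤ (R ∩ R') z a {a, a'} :=
      ha.mono le_top (fun w hw hwR => ⟨hwR, mem_R' w (.inl hw)⟩) (by simp)
    have hp : D.HasPathIn ⊤ (R ∩ R') z z' {a, a'} :=
      .of_walk p le_top fun w hw _ => ⟨mem_R w (.inr hw), mem_R' w (.inr hw)⟩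
    have ha' : D.HasPathIn ⊤ (R ∩ R') z' a' {a, a'} :=
      ha'.mono le_top (fun w hw hwR => ⟨mem_R w (.inl hw), hwR⟩) (by simp)
    exact (ha.symm.trans hp).trans ha'
  exact {
    curve_left := h'.isCycleOf.curve_subset hD h'.isSideOf h.isCycleOf fun y hy =>
      mem_R' y (.inl hy)
    curve_right := h.isCycleOf.curve_subset hD h.isSideOf h'.isCycleOf fun y hy =>
      mem_R y (.inl hy)
    path_u := link h.path_u h'.path_u
    path_v := link h.path_v h'.path_v }

theorem Linked.interior_subset (h : Linked H C C' C.exterior R') (hD : D.IsOnePlanar)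
    (hC : C.IsCycleOf H) (hR' : IsSideOf R' C'.curve) : C.interior ⊆ R' :=
  C.isSideOf_interior.subset hR' (isCompact_curve hD C).isClosed ⟨_, hC.pos_u_mem_curve⟩
    h.curve_left ((disjoint_inside_outside C.curve).mono_right h.curve_right)

theorem IsPosi.forbiddenFrom_of_isPosi (hD : D.IsOnePlanar) (h : C.IsPosi H) (h' : C'.IsPosi H)
    (hl : Linked H C C' C.exterior C'.exterior) : ForbiddenFrom H C C' := by
  refine ⟨h, .inl ⟨h', Set.disjoint_left.2 ?_, hl.path_u, hl.path_v⟩⟩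
  rintro _ ⟨⟨x, hx, rfl⟩, hf⟩ ⟨-, hf'⟩
  have hxf := mem_connectedComponentIn hx
  exact Set.disjoint_left.1 (disjoint_inside_outside C'.curve) (hf' hxf)
    (hl.interior_subset hD h.isCycleOf C'.isSideOf_exterior (hf hxf))

theorem IsPosi.forbiddenFrom_of_isNega (hD : D.IsOnePlanar) (h : C.IsPosi H) (h' : C'.IsNega H)
    (hl : Linked H C C' C.exterior C'.interior) : ForbiddenFrom H C C' :=
  ⟨h, .inr ⟨h', fun _ hf => ⟨hf.1, hf.2.trans
    (hl.interior_subset hD h.isCycleOf C'.isSideOf_interior)⟩, hl.path_u, hl.path_v⟩⟩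

theorem IsCycleOf.not_linked_interior_interior (hD : D.IsOnePlanar) (hC : C.IsCycleOf B) :
    ¬ Linked H C C' C.interior C'.interior := fun hl =>
  not_subset_inside_of_subset_inside (isCompact_curve hD C) (isCompact_curve hD C').isBounded
    ⟨_, hC.pos_u_mem_curve⟩ hl.curve_left hl.curve_right

end Linking

end Quad

end Drawing

end OnePlane

theorem lemma9_general {V : Type*} (G : SimpleGraph V) (D : OnePlane.Drawing G)
    (hD : D.IsOnePlanar) (hcirc : D.IsCircular)
    (B₁ B₂ : D.planarization.Subgraph)
    (hB₁ : OnePlane.IsBlock B₁) (hB₂ : OnePlane.IsBlock B₂) (hne : B₁ ≠ B₂)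
    (z₁ z₂ : V) (P : D.planarization.Walk (Sum.inl z₁) (Sum.inl z₂))
    (hP₁ : B₁.verts ∩ {w | w ∈ P.support} = {Sum.inl z₁})
    (hP₂ : B₂.verts ∩ {w | w ∈ P.support} = {Sum.inl z₂})
    (C₁ C₂ : D.Quad)
    (hC₁ : OnePlane.Drawing.Quad.HasInFactor B₁ C₁ z₁)
    (hC₂ : OnePlane.Drawing.Quad.HasInFactor B₂ C₂ z₂) :
    OnePlane.Drawing.Quad.IsForbiddenPair ⊤ C₁ C₂ := by
  have hj : OnePlane.Joins B₁ B₂ P := {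
    start_mem := (hP₁.ge rfl).1
    end_mem := (hP₂.ge rfl).1
    eq_start := fun w hw hwB => hP₁.le ⟨hwB, hw⟩
    eq_end := fun w hw hwB => hP₂.le ⟨hwB, hw⟩ }
  rcases hC₁.isPosi_or_isNega with ⟨h₁, hr₁⟩ | ⟨h₁, hr₁⟩ <;>
  rcases hC₂.isPosi_or_isNega with ⟨h₂, hr₂⟩ | ⟨h₂, hr₂⟩ <;>
  have hl := hr₁.linked hD hB₁ hB₂ hne hj hr₂
  · exact .inl ((h₁.top hD hcirc hB₁).forbiddenFrom_of_isPosi hD (h₂.top hD hcirc hB₂) hl)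
  · exact .inl ((h₁.top hD hcirc hB₁).forbiddenFrom_of_isNega hD (h₂.top hD hcirc hB₂) hl)
  · exact .inr ((h₂.top hD hcirc hB₂).forbiddenFrom_of_isNega hD (h₁.top hD hcirc hB₁) hl.symm)
  · exact (h₁.isCycleOf.not_linked_interior_interior hD hl).elim

theorem lemma9 {V : Type*} [Finite V] (G : SimpleGraph V) (D : OnePlane.Drawing G)
    (hD : D.IsOnePlanar) (hcirc : D.IsCircular)
    (hconn : OnePlane.HasConnectivityOne D.planarization)
    (B₁ B₂ : D.planarization.Subgraph)
    (hB₁ : OnePlane.IsBlock B₁) (hB₂ : OnePlane.IsBlock B₂) (hne : B₁ ≠ B₂)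
    (z₁ z₂ : V) (P : D.planarization.Walk (Sum.inl z₁) (Sum.inl z₂))
    (hP : P.IsPath)
    (hmin : ∀ Q : D.planarization.Walk (Sum.inl z₁) (Sum.inl z₂), P.length ≤ Q.length)
    (hP₁ : B₁.verts ∩ {w | w ∈ P.support} = {Sum.inl z₁})
    (hP₂ : B₂.verts ∩ {w | w ∈ P.support} = {Sum.inl z₂})
    (C₁ C₂ : D.Quad)
    (hC₁ : OnePlane.Drawing.Quad.HasInFactor B₁ C₁ z₁)
    (hC₂ : OnePlane.Drawing.Quad.HasInFactor B₂ C₂ z₂) :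
    OnePlane.Drawing.Quad.IsForbiddenPair ⊤ C₁ C₂ :=
  lemma9_general G D hD hcirc B₁ B₂ hB₁ hB₂ hne z₁ z₂ P hP₁ hP₂ C₁ C₂ hC₁ hC₂
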